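/- **Notation.** For a commutative ring $A$, the big Witt ring $W(A)$ has additive group $(1+tA[[t]],\times)$; its product $*$ is determined by functoriality in $A$, biadditivity, $t$-adic continuity and $(1-at)^{-1}*(1-bt)^{-1}=(1-abt)^{-1}$, with unit $(1-t)^{-1}$. For $m\ge 1$ the Frobenius $F_m:W(A)\to W(A)$ is the ring homomorphism, functorial in $A$ and $t$-adically continuous, with $F_m((1-at)^{-1})=(1-a^mt)^{-1}$. For a field $F$, the Grothendieck ring $GK_F$ is generated by the isomorphism classes $[X]$ of schemes $X$ of finite type over $F$, with relations $[X]=[Y]+[X-Y]$ for every closed subscheme $Y$ of $X$ and $[X]=[X_{\rm red}]$, product $[X][Y]=[X\times_F Y]$ and unit $[\operatorname{Spec}F]$; a field extension $F\to F'$ induces a ring homomorphism $b:GK_F\to GK_{F'}$, $[X]\mapsto[X\times_F F']$. A motivic measure with values in a commutative ring $R$ is an isomorphism-invariant function $\mu$ on schemes of finite type over $F$ with values in $R$ such that $\mu(X)=\mu(Y)+\mu(X-Y)$ for $Y\subset X$ closed, $\mu(X)=\mu(X_{\rm red})$, $\mu(X\times Y)=\mu(X)\mu(Y)$ and $\mu(\operatorname{Spec}F)=1$;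 equivalently, a ring homomorphism $GK_F\to R$. For $X$ of finite type over a finite field $k$, with set of closed points $|X|$, put $$Z(X,t)=\prod_{x\in|X|}(1-t^{\deg x})^{-1}\in W(\mathbb Z),\qquad \deg x=[k(x):k],$$ where $k(x)$ is the residue field at $x$ (all degrees are finite and there are finitely many closed points of each degree). **Theorem 2.1.** Let $k=\mathbb F_q$ be a finite field, and let $X,Y$ be schemes of finite type over $k$. (i) $Z(X\times Y,t)=Z(X,t)*Z(Y,t)$ in $W(\mathbb Z)$. In particular, $Z(X^n,t)$ is the $n$-th power of $Z(X,t)$ in the ring $W(\mathbb Z)$. (ii) There is a (unique) ring homomorphism $\kappa:GK_{\mathbb F_q}\to W(\mathbb Z)$ with $\kappa([X])=Z(X,t)$ for all $X$. Hence $X\mapsto Z(X,t)$ is a motivic measure. (iii) If $f:X\to B$ is a Zariski locally trivial fibre bundle with fibre $T$ (that is, $X,B,T$ are schemes of finite type over $k$, $f$ is a $k$-morphism, and $B$ is covered by Zariski opens $U$ with $X\times_BU\cong U\times_kT$ over $U$), then $Z(X,t)=Z(B,t)*Z(T,t)$. (iv) For every $m\ge1$, let $X_m$ be the base change of $X$ along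 $\mathbb F_q\to\mathbb F_{q^m}$, with zeta function formed over $\mathbb F_{q^m}$. Then $Z(X_m/\mathbb F_{q^m},t)=F_m(Z(X/\mathbb F_q,t))$. (v) With $b:GK_{\mathbb F_q}\to GK_{\mathbb F_{q^m}}$ the base change homomorphism and $\kappa$ as in (ii) over either field, $\kappa\circ b=F_m\circ\kappa$ as ring homomorphisms $GK_{\mathbb F_q}\to W(\mathbb Z)$. -/

import Mathlib

open PowerSeries in
/-- The underlying set of the big Witt ring `W(A)`: power series in `1 + tA⟦t⟧`. -/
@[ext]
structure BigWitt (A : Type*) [CommRing A] where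
  series : PowerSeries A
  constCoeff : constantCoeff series = 1

namespace BigWitt

open PowerSeries

section Group

variable {A : Type*} [CommRing A]

/-! The additive group of `W(A)` is the multiplicative group `1 + tA⟦t⟧`. -/

noncomputable instance : Zero (BigWitt A) := ⟨⟨1, by simp⟩⟩

noncomputable instance : Add (BigWitt A) :=
  ⟨fun P Q => ⟨P.series * Q.series, by simp [P.constCoeff, Q.constCoeff]⟩⟩

noncomputable instance : Neg (BigWitt A) :=
  ⟨fun P => ⟨invOfUnit P.series 1, by simp [constantCoeff_invOfUnit]⟩⟩

@[simp] theorem series_zero : (0 : BigWitt A).series = 1 := rfl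

@[simp] theorem series_add (P Q : BigWitt A) : (P + Q).series = P.series * Q.series := rfl

theorem series_neg_mul (P : BigWitt A) : (-P).series * P.series = 1 :=
  invOfUnit_mul _ _ (by simpa using P.constCoeff)

noncomputable instance : AddCommGroup (BigWitt A) where
  add_assoc P Q R := BigWitt.ext (mul_assoc _ _ _)
  zero_add P := BigWitt.ext (one_mul _)
  add_zero P := BigWitt.ext (mul_one _)
  add_comm P Q := BigWitt.ext (mul_comm _ _)
  neg_add_cancel P := BigWitt.ext (series_neg_mul P)
  nsmul := nsmulRec
  zsmul := zsmulRec

/-- `V_n [a] = (1 - a tⁿ)⁻¹`, for `n ≥ 1` (and `0` for `n = 0`). -/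
noncomputable def vTeich (n : ℕ) (a : A) : BigWitt A :=
  if hn : n = 0 then 0 else
    -⟨1 - C a * X ^ n, by simp [hn]⟩

/-- The Teichmüller map `[a] = (1 - a t)⁻¹`. -/
noncomputable def teich (a : A) : BigWitt A := vTeich 1 a

/-- The sum in `W(A)` of the `f n`, `n ≥ 1` (an infinite product of power series), where
`f n ≡ 1` modulo `tⁿ`, so that its coefficient of `t^k` is that of the sum over `1 ≤ n ≤ k`. -/
noncomputable def infSum (f : ℕ → BigWitt A) : BigWitt A where
  series := PowerSeries.mk fun k => coeff k (∑ n ∈ Finset.Icc 1 k, f n).series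
  constCoeff := by
    rw [← coeff_zero_eq_constantCoeff_apply, coeff_mk]
    simp

/-- `remainder P n` is what is left of `P` after splitting off the factors
`(1 - a_j t^j)⁻¹`, `1 ≤ j ≤ n`, of its product decomposition. -/
noncomputable def remainder (P : BigWitt A) : ℕ → BigWitt A
  | 0 => P
  | n + 1 => remainder P n - vTeich (n + 1) (coeff (n + 1) (remainder P n).series)

/-- The `n`-th Witt coordinate `a_n` of `P` (`n ≥ 1`), where `P = ∏_{n ≥ 1} (1 - a_n tⁿ)⁻¹`. -/
noncomputable def coord (P : BigWitt A) (n : ℕ) : A := coeff n (remainder P (n - 1)).series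

/-- The ghost components: `t P'(t) / P(t) = ∑ gh_r(P) t^r`. -/
noncomputable def ghost (r : ℕ) (P : BigWitt A) : A :=
  coeff r (X * derivative A P.series * (-P).series)

/-- The multiplicative unit is `[1] = (1 - t)⁻¹`. -/
noncomputable instance : One (BigWitt A) := ⟨teich 1⟩

/-- The Witt product: the biadditive extension, over the decomposition of the two factors in Witt
coordinates, of `V_n[a] * V_m[b] = gcd(n,m) • V_l[a^(l/n) b^(l/m)]`, `l = lcm(n,m)`.
In particular `[a] * [b] = [ab]`. -/
noncomputable instance : Mul (BigWitt A) :=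
  ⟨fun P Q => infSum fun l =>
    ∑ p ∈ (l.divisors ×ˢ l.divisors) with p.1.lcm p.2 = l,
      p.1.gcd p.2 • vTeich l (P.coord p.1 ^ (l / p.1) * Q.coord p.2 ^ (l / p.2))⟩

/-- The Frobenius `F_m` on the underlying sets: the additive extension, over the decomposition in
Witt coordinates, of `F_m (V_n[a]) = d • V_{n/d} [a^(m/d)]`, `d = gcd(n,m)`.
In particular `F_m [a] = [a^m]`. -/
noncomputable def frobFun (m : ℕ) (P : BigWitt A) : BigWitt A :=
  infSum fun l => ∑ n ∈ (l * m).divisors with n / n.gcd m = l,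
    n.gcd m • vTeich l (P.coord n ^ (m / n.gcd m))

/-- Functoriality: coefficientwise application of a ring homomorphism. -/
noncomputable def mapAdd {B : Type*} [CommRing B] (f : A →+* B) : BigWitt A →+ BigWitt B where
  toFun P := ⟨PowerSeries.map f P.series, by
    rw [← coeff_zero_eq_constantCoeff_apply, coeff_map, coeff_zero_eq_constantCoeff_apply,
      P.constCoeff, map_one]⟩
  map_zero' := BigWitt.ext (by simp)
  map_add' P Q := BigWitt.ext (by simp)

@[simp] theorem series_mapAdd {B : Type*} [CommRing B] (f : A →+* B) (P : BigWitt A) :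
    (mapAdd f P).series = PowerSeries.map f P.series := rfl

/-! The filtration by the order of vanishing of `P - 1`. -/

/-- The subgroup `1 + t^l A⟦t⟧`. -/
def fil (A : Type*) [CommRing A] (l : ℕ) : AddSubgroup (BigWitt A) where
  carrier := {P | X ^ l ∣ P.series - 1}
  zero_mem' := by simp
  add_mem' := by
    intro P Q hP hQ
    have : P.series * Q.series - 1 = P.series * (Q.series - 1) + (P.series - 1) := by ring
    simp only [Set.mem_ofPred_eq, series_add] at *
    rw [this]
    exact dvd_add (Dvd.dvd.mul_left hQ _) hP
  neg_mem' := by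
    intro P hP
    simp only [Set.mem_ofPred_eq] at *
    have : (-P).series - 1 = -((-P).series * (P.series - 1)) := by
      linear_combination series_neg_mul P
    rw [this]
    exact (Dvd.dvd.mul_left hP _).neg_right

theorem mem_fil {l : ℕ} {P : BigWitt A} : P ∈ fil A l ↔ X ^ l ∣ P.series - 1 := Iff.rfl

theorem fil_mono {l k : ℕ} (h : l ≤ k) {P : BigWitt A} (hP : P ∈ fil A k) : P ∈ fil A l :=
  (pow_dvd_pow _ h).trans hP

theorem sub_mem_fil {l : ℕ} {P Q : BigWitt A} :
    P - Q ∈ fil A l ↔ ∀ k < l, coeff k P.series = coeff k Q.series := by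
  have h1 : (P - Q).series - 1 = (-Q).series * (P.series - Q.series) := by
    rw [sub_eq_add_neg P Q, series_add]
    linear_combination series_neg_mul Q
  have h2 : P.series - Q.series = Q.series * ((P - Q).series - 1) := by
    rw [h1]; linear_combination - (P.series - Q.series) * series_neg_mul Q
  have h3 : P - Q ∈ fil A l ↔ X ^ l ∣ P.series - Q.series := by
    rw [mem_fil]
    constructor
    · intro h; rw [h2]; exact Dvd.dvd.mul_left h _
    · intro h; rw [h1]; exact Dvd.dvd.mul_left h _
  rw [h3, X_pow_dvd_iff]
  simp [sub_eq_zero]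

theorem vTeich_mem_fil (n : ℕ) (a : A) : vTeich n a ∈ fil A n := by
  by_cases hn : n = 0
  · subst hn; simp [mem_fil]
  · rw [vTeich, dif_neg hn]
    refine neg_mem ?_
    rw [mem_fil]
    exact ⟨-C a, by ring⟩

theorem infSum_sub_mem_fil {f : ℕ → BigWitt A} (hf : ∀ n, f n ∈ fil A n) (N : ℕ) :
    infSum f - ∑ n ∈ Finset.Icc 1 N, f n ∈ fil A (N + 1) := by
  rw [sub_mem_fil]
  intro k hk
  simp only [infSum, coeff_mk]
  have : ∑ n ∈ Finset.Icc 1 N, f n - ∑ n ∈ Finset.Icc 1 k, f n ∈ fil A (k + 1) := by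
    have h : Finset.Icc 1 N = Finset.Icc 1 k ∪ Finset.Icc (k + 1) N := by
      ext; simp; omega
    have hd : Disjoint (Finset.Icc 1 k) (Finset.Icc (k + 1) N) := by
      rw [Finset.disjoint_left]; intro a; simp; omega
    rw [h, Finset.sum_union hd, add_sub_cancel_left]
    refine sum_mem fun n hn => fil_mono ?_ (hf n)
    simp at hn; omega
  exact (sub_mem_fil.1 this k (by omega)).symm

/-! Ghost components. -/

theorem ghost_spec (P : BigWitt A) (G : PowerSeries A)
    (h : X * derivative A P.series = P.series * G) (r : ℕ) : ghost r P = coeff r G := by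
  rw [ghost, h]
  congr 1
  linear_combination G * series_neg_mul P

theorem ghost_eq (P : BigWitt A) : X * derivative A P.series =
    P.series * PowerSeries.mk fun r => ghost r P := by
  have : (PowerSeries.mk fun r => ghost r P) = X * derivative A P.series * (-P).series := by
    ext r; simp [ghost]
  rw [this]
  linear_combination - X * derivative A P.series * series_neg_mul P

theorem ghost_add (r : ℕ) (P Q : BigWitt A) : ghost r (P + Q) = ghost r P + ghost r Q := by
  rw [ghost_spec (P + Q) ((PowerSeries.mk fun r => ghost r P) + PowerSeries.mk fun r => ghost r Q)]
  · simp
  · rw [series_add, Derivation.leibniz]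
    simp only [smul_eq_mul]
    linear_combination P.series * ghost_eq Q + Q.series * ghost_eq P

/-- The ghost components as additive maps. -/
noncomputable def ghostHom (r : ℕ) : BigWitt A →+ A :=
  AddMonoidHom.mk' (ghost r) (ghost_add r)

theorem ghostHom_apply (r : ℕ) (P : BigWitt A) : ghostHom r P = ghost r P := rfl

theorem ghost_of_mem_fil {r l : ℕ} (h : r < l) {P : BigWitt A} (hP : P ∈ fil A l) :
    ghost r P = 0 := by
  obtain ⟨R, hR⟩ := hP
  have h1 : P.series = 1 + X ^ l * R := by rw [← hR]; ring
  have h2 : X ^ l ∣ X * derivative A P.series * (-P).series := by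
    refine Dvd.dvd.mul_right ?_ _
    rw [h1]
    obtain ⟨l, rfl⟩ : ∃ k, l = k + 1 := ⟨l - 1, by omega⟩
    simp only [map_add, Derivation.leibniz, smul_eq_mul, Derivation.leibniz_pow, derivative_X,
      Derivation.map_one_eq_zero]
    refine ⟨X * derivative A R + ((l + 1 : ℕ) : PowerSeries A) * R, ?_⟩
    simp
    ring
  exact X_pow_dvd_iff.1 h2 r h

theorem ghost_infSum {f : ℕ → BigWitt A} (hf : ∀ n, f n ∈ fil A n) (r : ℕ) :
    ghost r (infSum f) = ∑ n ∈ Finset.Icc 1 r, ghost r (f n) := by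
  have := ghost_of_mem_fil (Nat.lt_succ_self r) (infSum_sub_mem_fil hf r)
  rw [← ghostHom_apply, map_sub, sub_eq_zero] at this
  rw [← ghostHom_apply, this, map_sum]
  rfl

theorem ghost_vTeich {n k : ℕ} (hn : n ≠ 0) (hk : k ≠ 0) (a : A) :
    ghost k (vTeich n a) = if n ∣ k then n * a ^ (k / n) else 0 := by
  rw [vTeich, dif_neg hn, ← ghostHom_apply, map_neg, ghostHom_apply]
  rw [ghost_spec _ (PowerSeries.mk fun k => if n ∣ k ∧ k ≠ 0 then -(n * a ^ (k / n)) else 0)]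
  · by_cases h : n ∣ k <;> simp [h, hk]
  · ext j
    obtain ⟨n, rfl⟩ : ∃ k, n = k + 1 := ⟨n - 1, by omega⟩
    have e : X * derivative A (1 - C a * X ^ (n + 1)) = -(C ((n + 1 : ℕ) * a) * X ^ (n + 1)) := by
      simp [Derivation.leibniz, Derivation.leibniz_pow]
      ring
    rw [e, sub_mul, one_mul, mul_assoc, map_sub, map_neg, coeff_C_mul, coeff_C_mul, coeff_X_pow,
      coeff_X_pow_mul', coeff_mk]
    by_cases h1 : n + 1 ≤ j
    · rw [if_pos h1, coeff_mk]
      by_cases h2 : n + 1 ∣ j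
      · obtain ⟨c, rfl⟩ := h2
        have hc : c ≠ 0 := by rintro rfl; simp at h1
        obtain ⟨c, rfl⟩ := Nat.exists_eq_succ_of_ne_zero hc
        have e1 : (n + 1) * (c + 1) - (n + 1) = (n + 1) * c := by
          rw [Nat.mul_succ]; omega
        simp only [Nat.succ_eq_add_one, e1, dvd_mul_right, true_and]
        by_cases h0 : c = 0
        · subst h0; simp
        · have : ¬ ((n + 1) * (c + 1) = n + 1) := by
            intro h
            apply h0
            have := Nat.eq_of_mul_eq_mul_left (Nat.succ_pos n) (h.trans (mul_one _).symm)
            omega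
          simp [h0, this]
          ring
      · have h3 : ¬ n + 1 ∣ j - (n + 1) := by
          intro h
          apply h2
          have := Nat.dvd_add h (dvd_refl (n + 1))
          rwa [Nat.sub_add_cancel h1] at this
        have h4 : j ≠ n + 1 := by rintro rfl; exact h2 dvd_rfl
        simp [h2, h3, h4]
    · have h4 : j ≠ n + 1 := by omega
      rw [if_neg h1, if_neg h4]
      have : ¬ (n + 1 ∣ j ∧ j ≠ 0) := by
        rintro ⟨h, h'⟩
        exact h1 (Nat.le_of_dvd (Nat.pos_of_ne_zero h') h)
      simp only [if_neg this]
      simp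

theorem remainder_eq (P : BigWitt A) (n : ℕ) :
    remainder P n = P - ∑ j ∈ Finset.Icc 1 n, vTeich j (P.coord j) := by
  induction n with
  | zero => simp [remainder]
  | succ n ih =>
    rw [Finset.sum_Icc_succ_top (by omega), ← sub_sub, ← ih]
    simp [remainder, coord]

theorem coeff_vTeich (n : ℕ) (a : A) (k : ℕ) (hk : k ≤ n) (hn : n ≠ 0) :
    coeff k (vTeich n a).series = coeff k (1 + C a * X ^ n) := by
  have h := series_neg_mul (⟨1 - C a * X ^ n, by simp [hn]⟩ : BigWitt A)
  have h' : (vTeich n a).series * (1 - C a * X ^ n) = 1 := by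
    rw [vTeich, dif_neg hn]; exact h
  have hV : X ^ n ∣ (vTeich n a).series - 1 := vTeich_mem_fil n a
  obtain ⟨R, hR⟩ := hV
  have : X ^ (n + 1) ∣ (vTeich n a).series - (1 + C a * X ^ n) := by
    have e : (vTeich n a).series - (1 + C a * X ^ n) = X ^ n * X ^ n * (C a * R) := by
      linear_combination h' + C a * X ^ n * hR
    rw [e, ← pow_add]
    exact Dvd.dvd.mul_right (pow_dvd_pow _ (by omega)) _
  have := X_pow_dvd_iff.1 this k (by omega)
  rwa [map_sub, sub_eq_zero] at this

theorem remainder_mem_fil (P : BigWitt A) (n : ℕ) : remainder P n ∈ fil A (n + 1) := by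
  induction n with
  | zero =>
    simp only [remainder, mem_fil, zero_add, pow_one]
    rw [X_dvd_iff]; simp [P.constCoeff]
  | succ n ih =>
    rw [remainder, sub_mem_fil]
    intro k hk
    rw [coeff_vTeich _ _ _ (by omega) (by omega)]
    have h := (X_pow_dvd_iff.1 (mem_fil.1 ih)) k
    by_cases h1 : k = n + 1
    · subst h1; simp [coeff_one]
    · have := h (by omega)
      rw [map_sub, sub_eq_zero] at this
      rw [this]
      simp [coeff_X_pow, h1]

/-- The product decomposition `P = ∏_{n ≥ 1} (1 - a_n tⁿ)⁻¹`. -/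
theorem infSum_coord (P : BigWitt A) : infSum (fun n => vTeich n (P.coord n)) = P := by
  ext k
  have h1 := infSum_sub_mem_fil (fun n => vTeich_mem_fil n (P.coord n)) k
  have h2 := remainder_mem_fil P k
  rw [remainder_eq] at h2
  have h3 := sub_mem h1 h2
  rw [sub_sub_sub_cancel_right] at h3
  exact sub_mem_fil.1 h3 k (by omega)

theorem ghost_coord (P : BigWitt A) {k : ℕ} (hk : k ≠ 0) :
    ghost k P = ∑ n ∈ k.divisors, n * P.coord n ^ (k / n) := by
  conv_lhs => rw [← infSum_coord P]
  rw [ghost_infSum (fun n => vTeich_mem_fil n _)]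
  have : k.divisors = (Finset.Icc 1 k).filter (· ∣ k) := by
    ext d; simp only [Nat.mem_divisors, Finset.mem_filter, Finset.mem_Icc]
    constructor
    · rintro ⟨h, _⟩
      exact ⟨⟨Nat.pos_of_dvd_of_pos h (Nat.pos_of_ne_zero hk),
        Nat.le_of_dvd (Nat.pos_of_ne_zero hk) h⟩, h⟩
    · rintro ⟨_, h⟩; exact ⟨h, hk⟩
  rw [this, Finset.sum_filter]
  refine Finset.sum_congr rfl fun n hn => ?_
  rw [ghost_vTeich _ hk]
  simp at hn; omega

theorem ghost_one {k : ℕ} (hk : k ≠ 0) : ghost k (1 : BigWitt A) = 1 := by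
  change ghost k (vTeich 1 1) = 1
  rw [ghost_vTeich one_ne_zero hk]; simp

theorem mul_def (P Q : BigWitt A) : P * Q = infSum fun l =>
    ∑ p ∈ (l.divisors ×ˢ l.divisors) with p.1.lcm p.2 = l,
      p.1.gcd p.2 • vTeich l (P.coord p.1 ^ (l / p.1) * Q.coord p.2 ^ (l / p.2)) := rfl

theorem Icc_sum_eq_divisors {M : Type*} [AddCommMonoid M] {k : ℕ} (hk : k ≠ 0) (f : ℕ → M) :
    (∑ l ∈ Finset.Icc 1 k, if l ∣ k then f l else 0) = ∑ l ∈ k.divisors, f l := by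
  have : k.divisors = (Finset.Icc 1 k).filter (· ∣ k) := by
    ext d; simp only [Nat.mem_divisors, Finset.mem_filter, Finset.mem_Icc]
    constructor
    · rintro ⟨h, _⟩
      exact ⟨⟨Nat.pos_of_dvd_of_pos h (Nat.pos_of_ne_zero hk),
        Nat.le_of_dvd (Nat.pos_of_ne_zero hk) h⟩, h⟩
    · rintro ⟨_, h⟩; exact ⟨h, hk⟩
  rw [this, Finset.sum_filter]

theorem ghost_mul (P Q : BigWitt A) {k : ℕ} (hk : k ≠ 0) :
    ghost k (P * Q) = ghost k P * ghost k Q := by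
  rw [mul_def, ghost_infSum (fun l => sum_mem fun p _ => nsmul_mem (vTeich_mem_fil _ _) _)]
  have h1 : ∀ l ∈ Finset.Icc 1 k, ghost k (∑ p ∈ (l.divisors ×ˢ l.divisors) with p.1.lcm p.2 = l,
      p.1.gcd p.2 • vTeich l (P.coord p.1 ^ (l / p.1) * Q.coord p.2 ^ (l / p.2))) =
      if l ∣ k then ∑ p ∈ (k.divisors ×ˢ k.divisors) with p.1.lcm p.2 = l,
        (p.1 * P.coord p.1 ^ (k / p.1)) * (p.2 * Q.coord p.2 ^ (k / p.2)) else 0 := by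
    intro l hl
    have hl0 : l ≠ 0 := by simp at hl; omega
    rw [← ghostHom_apply, map_sum]
    simp_rw [map_nsmul, ghostHom_apply, ghost_vTeich hl0 hk]
    split_ifs with h
    · have e : ((l.divisors ×ˢ l.divisors).filter fun p => p.1.lcm p.2 = l) =
          (k.divisors ×ˢ k.divisors).filter fun p => p.1.lcm p.2 = l := by
        ext ⟨n, m⟩
        simp only [Finset.mem_filter, Finset.mem_product, Nat.mem_divisors]
        constructor
        · rintro ⟨⟨⟨a, _⟩, ⟨b, _⟩⟩, c⟩
          exact ⟨⟨⟨a.trans h, hk⟩, ⟨b.trans h, hk⟩⟩, c⟩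
        · rintro ⟨_, c⟩
          exact ⟨⟨⟨c ▸ Nat.dvd_lcm_left _ _, hl0⟩, ⟨c ▸ Nat.dvd_lcm_right _ _, hl0⟩⟩, c⟩
      rw [e]
      refine Finset.sum_congr rfl ?_
      rintro ⟨n, m⟩ hp
      simp only [Finset.mem_filter, Finset.mem_product, Nat.mem_divisors] at hp
      obtain ⟨_, c⟩ := hp
      have hn : n ∣ l := c ▸ Nat.dvd_lcm_left _ _
      have hm : m ∣ l := c ▸ Nat.dvd_lcm_right _ _
      have e1 : l / n * (k / l) = k / n := by
        rw [Nat.div_mul_div_comm hn h, mul_comm n l]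
        exact Nat.mul_div_mul_left _ _ (Nat.pos_of_ne_zero hl0)
      have e2 : l / m * (k / l) = k / m := by
        rw [Nat.div_mul_div_comm hm h, mul_comm m l]
        exact Nat.mul_div_mul_left _ _ (Nat.pos_of_ne_zero hl0)
      have e3 : (n.gcd m : A) * l = n * m := by
        rw [← c]; exact_mod_cast congrArg (Nat.cast (R := A)) (Nat.gcd_mul_lcm n m)
      simp only [nsmul_eq_mul]
      rw [mul_pow, ← pow_mul, ← pow_mul, e1, e2]
      linear_combination (P.coord n ^ (k / n) * Q.coord m ^ (k / m)) * e3
    · simp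
  rw [Finset.sum_congr rfl h1, Icc_sum_eq_divisors hk, ghost_coord P hk, ghost_coord Q hk,
    Finset.sum_mul_sum, ← Finset.sum_product']
  refine Finset.sum_fiberwise_of_maps_to (g := fun p : ℕ × ℕ => p.1.lcm p.2) ?_ _
  rintro ⟨n, m⟩ h
  simp only [Finset.mem_product, Nat.mem_divisors] at h ⊢
  exact ⟨Nat.lcm_dvd h.1.1 h.2.1, hk⟩

theorem ghost_frobFun {m : ℕ} (hm : m ≠ 0) (P : BigWitt A) {k : ℕ} (hk : k ≠ 0) :
    ghost k (frobFun m P) = ghost (k * m) P := by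
  rw [frobFun, ghost_infSum (fun l => sum_mem fun p _ => nsmul_mem (vTeich_mem_fil _ _) _)]
  have hkm : k * m ≠ 0 := mul_ne_zero hk hm
  have h1 : ∀ l ∈ Finset.Icc 1 k, ghost k (∑ n ∈ (l * m).divisors with n / n.gcd m = l,
      n.gcd m • vTeich l (P.coord n ^ (m / n.gcd m))) =
      if l ∣ k then ∑ n ∈ (k * m).divisors with n / n.gcd m = l,
        (n * P.coord n ^ (k * m / n)) else 0 := by
    intro l hl
    have hl0 : l ≠ 0 := by simp at hl; omega
    rw [← ghostHom_apply, map_sum]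
    simp_rw [map_nsmul, ghostHom_apply, ghost_vTeich hl0 hk]
    split_ifs with h
    · have e : ((l * m).divisors.filter fun n => n / n.gcd m = l) =
          (k * m).divisors.filter fun n => n / n.gcd m = l := by
        ext n
        simp only [Finset.mem_filter, Nat.mem_divisors]
        constructor
        · rintro ⟨⟨a, _⟩, c⟩
          exact ⟨⟨a.trans (Nat.mul_dvd_mul_right h m), hkm⟩, c⟩
        · rintro ⟨_, c⟩
          refine ⟨⟨?_, mul_ne_zero hl0 hm⟩, c⟩
          have := Nat.div_mul_cancel (Nat.gcd_dvd_left n m)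
          rw [c] at this
          have h2 := Nat.mul_dvd_mul_left l (Nat.gcd_dvd_right n m)
          rwa [this] at h2
      rw [e]
      refine Finset.sum_congr rfl ?_
      intro n hp
      simp only [Finset.mem_filter, Nat.mem_divisors] at hp
      obtain ⟨_, c⟩ := hp
      set d := n.gcd m with hd
      have hd0 : 0 < d := Nat.gcd_pos_of_pos_right _ (Nat.pos_of_ne_zero hm)
      have hn : n = l * d := by rw [← c]; exact (Nat.div_mul_cancel (Nat.gcd_dvd_left n m)).symm
      have hm' : m = m / d * d := (Nat.div_mul_cancel (Nat.gcd_dvd_right n m)).symm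
      obtain ⟨k', rfl⟩ := h
      have e1 : m / d * (l * k' / l) = l * k' * m / n := by
        rw [Nat.mul_div_cancel_left _ (Nat.pos_of_ne_zero hl0)]
        symm
        apply Nat.div_eq_of_eq_mul_right
        · rw [hn]; exact Nat.mul_pos (Nat.pos_of_ne_zero hl0) hd0
        · conv_lhs => rw [hm']
          conv_rhs => rw [hn]
          ring
      rw [← pow_mul, e1, nsmul_eq_mul, ← mul_assoc]
      congr 1
      conv_rhs => rw [hn]
      push_cast; ring
    · simp
  rw [Finset.sum_congr rfl h1, Icc_sum_eq_divisors hk, ghost_coord P hkm]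
  refine Finset.sum_fiberwise_of_maps_to (g := fun n : ℕ => n / n.gcd m) ?_ _
  intro n h
  simp only [Nat.mem_divisors] at h ⊢
  refine ⟨?_, hk⟩
  have hd0 : 0 < n.gcd m := Nat.gcd_pos_of_pos_right _ (Nat.pos_of_ne_zero hm)
  have hco := Nat.coprime_div_gcd_div_gcd hd0
  refine hco.dvd_of_dvd_mul_right ?_
  rw [← Nat.mul_div_assoc _ (Nat.gcd_dvd_right n m)]
  exact Nat.div_dvd_div (Nat.gcd_dvd_left n m) h.1

theorem eq_of_ghost [IsDomain A] [CharZero A] {P Q : BigWitt A}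
    (h : ∀ k, k ≠ 0 → ghost k P = ghost k Q) : P = Q := by
  rw [← sub_eq_zero]
  have h' : ∀ k, ghost k (P - Q) = 0 := by
    intro k
    by_cases hk : k = 0
    · subst hk; simp [ghost]
    · rw [← ghostHom_apply, map_sub, ghostHom_apply, ghostHom_apply, h k hk, sub_self]
  have e := ghost_eq (P - Q)
  have e0 : (PowerSeries.mk fun r => ghost r (P - Q)) = 0 := by ext r; simp [h']
  rw [e0, mul_zero] at e
  ext k
  rcases k with _ | k
  · simp [(P - Q).constCoeff]
  · have := congrArg (coeff (k + 1)) e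
    rw [coeff_succ_X_mul, coeff_derivative, map_zero] at this
    have hk : (k : A) + 1 ≠ 0 := by exact_mod_cast Nat.succ_ne_zero k
    rw [(mul_eq_zero.1 this).resolve_right hk]
    simp [coeff_one]

/-! Functoriality of all constructions. -/

variable {B : Type*} [CommRing B] (f : A →+* B)

theorem mapAdd_vTeich (n : ℕ) (a : A) : mapAdd f (vTeich n a) = vTeich n (f a) := by
  by_cases hn : n = 0
  · simp [vTeich, hn]
  · rw [vTeich, vTeich, dif_neg hn, dif_neg hn, map_neg]
    congr 1
    exact BigWitt.ext (by simp)

theorem mapAdd_infSum (g : ℕ → BigWitt A) :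
    mapAdd f (infSum g) = infSum fun n => mapAdd f (g n) := by
  ext k
  simp only [infSum, series_mapAdd, coeff_map, coeff_mk]
  rw [← map_sum, series_mapAdd, coeff_map]

theorem mapAdd_remainder (P : BigWitt A) (n : ℕ) :
    mapAdd f (remainder P n) = remainder (mapAdd f P) n := by
  induction n with
  | zero => rfl
  | succ n ih => simp only [remainder, map_sub, ih, mapAdd_vTeich, ← coeff_map, ← series_mapAdd]

theorem coord_mapAdd (P : BigWitt A) (n : ℕ) : (mapAdd f P).coord n = f (P.coord n) := by
  rw [coord, coord, ← mapAdd_remainder, series_mapAdd, coeff_map]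

theorem mapAdd_mul (P Q : BigWitt A) : mapAdd f (P * Q) = mapAdd f P * mapAdd f Q := by
  simp only [mul_def, mapAdd_infSum, map_sum, map_nsmul, mapAdd_vTeich, coord_mapAdd, map_mul,
    map_pow]

theorem mapAdd_frobFun (m : ℕ) (P : BigWitt A) :
    mapAdd f (frobFun m P) = frobFun m (mapAdd f P) := by
  simp only [frobFun, mapAdd_infSum, map_sum, map_nsmul, mapAdd_vTeich, coord_mapAdd, map_pow]

theorem mapAdd_one : mapAdd f (1 : BigWitt A) = 1 := by
  change mapAdd f (vTeich 1 1) = vTeich 1 1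
  rw [mapAdd_vTeich, map_one]

theorem mapAdd_surjective (hf : Function.Surjective f) : Function.Surjective (mapAdd f) := by
  intro P
  choose g hg using hf
  refine ⟨⟨PowerSeries.mk fun k => if k = 0 then 1 else g (coeff k P.series), ?_⟩, ?_⟩
  · rw [← coeff_zero_eq_constantCoeff_apply, coeff_mk, if_pos rfl]
  · ext k
    rw [series_mapAdd, coeff_map, coeff_mk]
    by_cases hk : k = 0
    · subst hk; simp [P.constCoeff]
    · rw [if_neg hk, hg]

end Group

/-- The tautological surjection of `ℤ[x_a, a ∈ A]` onto `A`. -/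
noncomputable def polyHom (A : Type*) [CommRing A] : MvPolynomial A ℤ →+* A :=
  MvPolynomial.eval₂Hom (Int.castRingHom A) id

theorem polyHom_surjective (A : Type*) [CommRing A] : Function.Surjective (polyHom A) :=
  fun a => ⟨MvPolynomial.X a, by simp [polyHom]⟩

/-- Every Witt vector lifts to a domain of characteristic zero. -/
theorem exists_lift (A : Type*) [CommRing A] : Function.Surjective (mapAdd (polyHom A)) :=
  mapAdd_surjective _ (polyHom_surjective A)

variable {A : Type*} [CommRing A]

/-- The big Witt ring `W(A)`. -/
noncomputable instance : CommRing (BigWitt A) where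
  __ := (inferInstance : AddCommGroup (BigWitt A))
  mul_assoc P Q R := by
    obtain ⟨P, rfl⟩ := exists_lift A P
    obtain ⟨Q, rfl⟩ := exists_lift A Q
    obtain ⟨R, rfl⟩ := exists_lift A R
    simp only [← mapAdd_mul]
    refine congrArg _ ?_
    exact eq_of_ghost fun k hk => by simp only [ghost_mul _ _ hk, mul_assoc]
  mul_comm P Q := by
    obtain ⟨P, rfl⟩ := exists_lift A P
    obtain ⟨Q, rfl⟩ := exists_lift A Q
    simp only [← mapAdd_mul]
    refine congrArg _ ?_
    exact eq_of_ghost fun k hk => by rw [ghost_mul _ _ hk, ghost_mul _ _ hk, mul_comm]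
  one_mul P := by
    obtain ⟨P, rfl⟩ := exists_lift A P
    rw [← mapAdd_one (polyHom A), ← mapAdd_mul]
    refine congrArg _ ?_
    exact eq_of_ghost fun k hk => by simp only [ghost_mul _ _ hk, ghost_one hk, one_mul]
  mul_one P := by
    obtain ⟨P, rfl⟩ := exists_lift A P
    rw [← mapAdd_one (polyHom A), ← mapAdd_mul]
    refine congrArg _ ?_
    exact eq_of_ghost fun k hk => by simp only [ghost_mul _ _ hk, ghost_one hk, mul_one]
  left_distrib P Q R := by
    obtain ⟨P, rfl⟩ := exists_lift A P
    obtain ⟨Q, rfl⟩ := exists_lift A Q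
    obtain ⟨R, rfl⟩ := exists_lift A R
    simp only [← mapAdd_mul, ← (mapAdd (polyHom A)).map_add]
    refine congrArg _ ?_
    exact eq_of_ghost fun k hk => by simp only [ghost_mul _ _ hk, ghost_add, mul_add]
  right_distrib P Q R := by
    obtain ⟨P, rfl⟩ := exists_lift A P
    obtain ⟨Q, rfl⟩ := exists_lift A Q
    obtain ⟨R, rfl⟩ := exists_lift A R
    simp only [← mapAdd_mul, ← (mapAdd (polyHom A)).map_add]
    refine congrArg _ ?_
    exact eq_of_ghost fun k hk => by simp only [ghost_mul _ _ hk, ghost_add, add_mul]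
  zero_mul P := by
    obtain ⟨P, rfl⟩ := exists_lift A P
    rw [← (mapAdd (polyHom A)).map_zero, ← mapAdd_mul]
    refine congrArg _ ?_
    refine eq_of_ghost fun k hk => ?_
    simp only [ghost_mul _ _ hk]
    simp only [← ghostHom_apply, map_zero, zero_mul]
  mul_zero P := by
    obtain ⟨P, rfl⟩ := exists_lift A P
    rw [← (mapAdd (polyHom A)).map_zero, ← mapAdd_mul]
    refine congrArg _ ?_
    refine eq_of_ghost fun k hk => ?_
    simp only [ghost_mul _ _ hk]
    simp only [← ghostHom_apply, map_zero, mul_zero]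

/-- The defining property of the Witt product on Teichmüller elements. -/
theorem teich_mul (a b : A) : teich a * teich b = teich (a * b) := by
  obtain ⟨x, rfl⟩ := polyHom_surjective A a
  obtain ⟨y, rfl⟩ := polyHom_surjective A b
  have : teich x * teich y = teich (x * y) := eq_of_ghost fun k hk => by
    simp only [ghost_mul _ _ hk, teich, ghost_vTeich one_ne_zero hk]; simp [mul_pow]
  have := congrArg (mapAdd (polyHom A)) this
  simpa only [mapAdd_mul, teich, mapAdd_vTeich, map_mul] using this

/-- Functoriality of `W`: the ring homomorphism `W(f)`. -/
noncomputable def map {B : Type*} [CommRing B] (f : A →+* B) : BigWitt A →+* BigWitt B where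
  __ := mapAdd f
  map_one' := mapAdd_one f
  map_mul' := mapAdd_mul f

/-- The Frobenius ring homomorphism `F_m : W(A) → W(A)`, `m ≥ 1`. -/
noncomputable def frobenius (m : ℕ+) : BigWitt A →+* BigWitt A where
  toFun := frobFun m
  map_one' := by
    rw [← mapAdd_one (Int.castRingHom A), ← mapAdd_frobFun]
    refine congrArg _ ?_
    refine eq_of_ghost fun k hk => ?_
    rw [ghost_frobFun m.ne_zero _ hk, ghost_one hk, ghost_one (mul_ne_zero hk m.ne_zero)]
  map_zero' := by
    rw [← map_zero (mapAdd (Int.castRingHom A)), ← mapAdd_frobFun]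
    refine congrArg _ ?_
    refine eq_of_ghost fun k hk => ?_
    rw [ghost_frobFun m.ne_zero _ hk]
    simp only [← ghostHom_apply, map_zero]
  map_mul' P Q := by
    obtain ⟨P, rfl⟩ := exists_lift A P
    obtain ⟨Q, rfl⟩ := exists_lift A Q
    simp only [← mapAdd_mul, ← mapAdd_frobFun]
    refine congrArg _ ?_
    refine eq_of_ghost fun k hk => ?_
    simp only [ghost_mul _ _ hk, ghost_frobFun m.ne_zero _ hk,
      ghost_mul _ _ (mul_ne_zero hk m.ne_zero)]
  map_add' P Q := by
    obtain ⟨P, rfl⟩ := exists_lift A P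
    obtain ⟨Q, rfl⟩ := exists_lift A Q
    simp only [← (mapAdd (polyHom A)).map_add, ← mapAdd_frobFun]
    refine congrArg _ ?_
    refine eq_of_ghost fun k hk => ?_
    simp only [ghost_add, ghost_frobFun m.ne_zero _ hk]

/-- The defining property of the Frobenius on Teichmüller elements. -/
theorem frobenius_teich (m : ℕ+) (a : A) : frobenius m (teich a) = teich (a ^ (m : ℕ)) := by
  obtain ⟨x, rfl⟩ := polyHom_surjective A a
  have : frobFun (m : ℕ) (teich x) = teich (x ^ (m : ℕ)) := eq_of_ghost fun k hk => by
    simp only [ghost_frobFun m.ne_zero _ hk, teich, ghost_vTeich one_ne_zero hk,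
      ghost_vTeich one_ne_zero (mul_ne_zero hk m.ne_zero)]
    simp [← pow_mul, mul_comm]
  have := congrArg (mapAdd (polyHom A)) this
  change frobFun (m : ℕ) _ = _
  simpa only [mapAdd_frobFun, teich, mapAdd_vTeich, map_pow] using this

end BigWitt

section Schemes

open AlgebraicGeometry CategoryTheory CategoryTheory.Limits

universe u v

/-- A scheme of finite type over `Spec F`. -/
structure SchFT (F : Type u) [Field F] where
  X : Scheme.{u}
  π : X ⟶ Spec (.of F)
  lft : LocallyOfFiniteType π
  qc : QuasiCompact π

namespace SchFT

attribute [instance] SchFT.lft SchFT.qc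

variable {F : Type u} [Field F]

/-- Isomorphism of schemes over `F`. -/
def IsIsoOver (X Y : SchFT F) : Prop := ∃ e : X.X ≅ Y.X, e.hom ≫ Y.π = X.π

variable (F) in
/-- The point `Spec F`. -/
noncomputable def point : SchFT F := ⟨Spec (.of F), 𝟙 _, inferInstance, inferInstance⟩

/-- The product `X × Y` over `Spec F`. -/
noncomputable def prod (X Y : SchFT F) : SchFT F :=
  ⟨pullback X.π Y.π, pullback.fst X.π Y.π ≫ X.π, inferInstance, inferInstance⟩

/-- The first projection of the product. -/
noncomputable def prodFst (X Y : SchFT F) : (X.prod Y).X ⟶ X.X := pullback.fst X.π Y.π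

/-- The second projection of the product. -/
noncomputable def prodSnd (X Y : SchFT F) : (X.prod Y).X ⟶ Y.X := pullback.snd X.π Y.π

theorem prodFst_π (X Y : SchFT F) : prodFst X Y ≫ X.π = (X.prod Y).π := rfl

theorem prodSnd_π (X Y : SchFT F) : prodSnd X Y ≫ Y.π = (X.prod Y).π :=
  pullback.condition.symm

theorem prod_isPullback (X Y : SchFT F) : IsPullback (prodFst X Y) (prodSnd X Y) X.π Y.π :=
  IsPullback.of_hasPullback _ _

/-- The `n`-fold product of `X` with itself over `Spec F`. -/
noncomputable def npow (X : SchFT F) : ℕ → SchFT F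
  | 0 => point F
  | n + 1 => prod (npow X n) X

/-- The base change `X ×_F Spec K`, over `K`. -/
noncomputable def baseChange (K : Type u) [Field K] [Algebra F K] (X : SchFT F) : SchFT K :=
  ⟨pullback X.π (Spec.map (CommRingCat.ofHom (algebraMap F K))), pullback.snd _ _,
    inferInstance, inferInstance⟩

/-- `U` is the open complement `X - Y` in `X` of its closed subscheme `Y`. -/
def IsClosedOpenPartition (X Y U : SchFT F) : Prop :=
  ∃ (i : Y.X ⟶ X.X) (j : U.X ⟶ X.X), IsClosedImmersion i ∧ IsOpenImmersion j ∧
    i ≫ X.π = Y.π ∧ j ≫ X.π = U.π ∧ Set.range j = (Set.range i)ᶜ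

/-- `Y` is `X_red`: the reduced closed subscheme of `X` with the same underlying space. -/
def IsReduction (X Y : SchFT F) : Prop :=
  ∃ i : Y.X ⟶ X.X, IsClosedImmersion i ∧ Function.Surjective i ∧ IsReduced Y.X ∧ i ≫ X.π = Y.π

end SchFT

/-- A motivic measure on schemes of finite type over `F`, with values in `R`. -/
structure IsMotivicMeasure {F : Type u} [Field F] {R : Type v} [CommRing R] (μ : SchFT F → R) :
    Prop where
  iso : ∀ X Y, X.IsIsoOver Y → μ X = μ Y
  add : ∀ X Y U, X.IsClosedOpenPartition Y U → μ X = μ Y + μ U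
  red : ∀ X Y, X.IsReduction Y → μ X = μ Y
  mul : ∀ X Y, μ (X.prod Y) = μ X * μ Y
  one : μ (SchFT.point F) = 1

/-- The relations of the Grothendieck ring between the classes of schemes. -/
inductive GKRel (F : Type u) [Field F] : MvPolynomial (SchFT F) ℤ → MvPolynomial (SchFT F) ℤ → Prop
  | iso (X Y : SchFT F) : X.IsIsoOver Y → GKRel F (.X X) (.X Y)
  | add (X Y U : SchFT F) : X.IsClosedOpenPartition Y U → GKRel F (.X X) (.X Y + .X U)
  | red (X Y : SchFT F) : X.IsReduction Y → GKRel F (.X X) (.X Y)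
  | mul (X Y : SchFT F) : GKRel F (.X (X.prod Y)) (.X X * .X Y)
  | one : GKRel F (.X (SchFT.point F)) 1

/-- The Grothendieck ring of schemes of finite type over `F`: the commutative ring generated by the
classes `[X]`, subject to the relations: `[X] = [Y]` for `X ≅ Y`, `[X] = [Y] + [X - Y]` for a closed
subscheme `Y` of `X`, `[X] = [X_red]`, `[X × Y] = [X] [Y]` and `[Spec F] = 1`. By the last two, it
is additively generated by the classes `[X]`. -/
def GK (F : Type u) [Field F] : Type (u + 1) :=
  MvPolynomial (SchFT F) ℤ ⧸ Ideal.span {p | ∃ a b, GKRel F a b ∧ p = a - b}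

namespace GK

variable {F : Type u} [Field F]

noncomputable instance : CommRing (GK F) :=
  inferInstanceAs (CommRing (MvPolynomial (SchFT F) ℤ ⧸ _))

/-- The class `[X]`. -/
noncomputable def cls (X : SchFT F) : GK F := Ideal.Quotient.mk _ (.X X)

theorem mk_eq {a b : MvPolynomial (SchFT F) ℤ} (h : GKRel F a b) :
    (Ideal.Quotient.mk (Ideal.span {p | ∃ a b, GKRel F a b ∧ p = a - b}) a) =
      Ideal.Quotient.mk _ b :=
  Ideal.Quotient.eq.2 (Ideal.subset_span ⟨a, b, h, rfl⟩)

/-- `X ↦ [X]` is a motivic measure (in fact the universal one). -/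
theorem isMotivicMeasure_cls : IsMotivicMeasure (cls (F := F)) where
  iso X Y h := mk_eq (.iso X Y h)
  add X Y U h := (mk_eq (.add X Y U h)).trans (map_add _ _ _)
  red X Y h := mk_eq (.red X Y h)
  mul X Y := (mk_eq (.mul X Y)).trans (map_mul _ _ _)
  one := (mk_eq .one).trans (map_one _)

/-- The ring homomorphism on the Grothendieck ring given by a motivic measure. -/
noncomputable def lift {R : Type v} [CommRing R] {μ : SchFT F → R} (h : IsMotivicMeasure μ) :
    GK F →+* R :=
  Ideal.Quotient.lift _ (MvPolynomial.eval₂Hom (Int.castRingHom R) μ) (by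
    intro a ha
    rw [← RingHom.mem_ker]
    refine Ideal.span_le.2 ?_ ha
    rintro _ ⟨a, b, hab, rfl⟩
    rw [SetLike.mem_coe, RingHom.mem_ker, map_sub, sub_eq_zero]
    cases hab with
    | iso X Y e => simpa using h.iso X Y e
    | add X Y U e => simpa using h.add X Y U e
    | red X Y e => simpa using h.red X Y e
    | mul X Y => simpa using h.mul X Y
    | one => simpa using h.one)

theorem lift_cls {R : Type v} [CommRing R] {μ : SchFT F → R} (h : IsMotivicMeasure μ)
    (X : SchFT F) : lift h (cls X) = μ X :=
  (Ideal.Quotient.lift_mk _ _ _).trans (MvPolynomial.eval₂Hom_X' _ _ _)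

/-- A surjective closed immersion does not change the class. -/
theorem cls_eq_of_surjective (X Y : SchFT F) (i : Y.X ⟶ X.X) [IsClosedImmersion i]
    (hi : Function.Surjective i) (h : i ≫ X.π = Y.π) : cls X = cls Y := by
  let e : SchFT F := ⟨(∅ : Scheme.{u}), Scheme.emptyTo _, inferInstance, inferInstance⟩
  have he : cls e = cls e + cls e := by
    refine isMotivicMeasure_cls.add e e e ⟨𝟙 _, 𝟙 _, inferInstance, inferInstance, by simp,
      by simp, ?_⟩
    ext x
    exact isEmptyElim (α := (∅ : Scheme.{u})) x
  have he' : cls e = 0 := by simpa using he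
  have := isMotivicMeasure_cls.add X Y e ⟨i, Scheme.emptyTo _, inferInstance, inferInstance, h,
    emptyIsInitial.hom_ext _ _, by
      rw [Set.range_eq_univ.2 hi, Set.compl_univ, Set.range_eq_empty_iff]
      exact inferInstanceAs (IsEmpty (∅ : Scheme.{u}))⟩
  rw [this, he', add_zero]

section BaseChange

variable (K : Type u) [Field K] [Algebra F K]

/-- The map `Y_K → X_K` induced by an `F`-morphism `Y → X`. -/
noncomputable def bcMap {X Y : SchFT F} (f : Y.X ⟶ X.X) (hf : f ≫ X.π = Y.π) :
    (Y.baseChange K).X ⟶ (X.baseChange K).X :=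
  pullback.map Y.π _ X.π _ f (𝟙 _) (𝟙 _) (by simp [hf]) (by simp)

theorem bcMap_π {X Y : SchFT F} (f : Y.X ⟶ X.X) (hf : f ≫ X.π = Y.π) :
    bcMap K f hf ≫ (X.baseChange K).π = (Y.baseChange K).π :=
  (pullback.lift_snd _ _ _).trans (Category.comp_id _)

/-- The projection `X_K → X`. -/
noncomputable def bcFst (X : SchFT F) : (X.baseChange K).X ⟶ X.X := pullback.fst _ _

theorem bcMap_fst {X Y : SchFT F} (f : Y.X ⟶ X.X) (hf : f ≫ X.π = Y.π) :
    bcMap K f hf ≫ bcFst K X = bcFst K Y ≫ f :=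
  pullback.lift_fst _ _ _

theorem bc_isPullback (X : SchFT F) : IsPullback (bcFst K X) (X.baseChange K).π X.π
    (Spec.map (CommRingCat.ofHom (algebraMap F K))) :=
  IsPullback.of_hasPullback _ _

theorem bcMap_isPullback {X Y : SchFT F} (f : Y.X ⟶ X.X) (hf : f ≫ X.π = Y.π) :
    IsPullback (bcMap K f hf) (bcFst K Y) (bcFst K X) f := by
  refine IsPullback.of_right (h₁₂ := (X.baseChange K).π) (h₂₂ := X.π)
    (v₁₃ := Spec.map (CommRingCat.ofHom (algebraMap F K))) ?_ (bcMap_fst K f hf)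
    (bc_isPullback K X).flip
  rw [bcMap_π, hf]
  exact (bc_isPullback K Y).flip

theorem range_bcMap {X Y : SchFT F} (f : Y.X ⟶ X.X) (hf : f ≫ X.π = Y.π) :
    Set.range (bcMap K f hf) = bcFst K X ⁻¹' Set.range f := by
  ext x
  constructor
  · rintro ⟨y, rfl⟩
    refine ⟨bcFst K Y y, ?_⟩
    rw [← Scheme.Hom.comp_apply, ← Scheme.Hom.comp_apply, bcMap_fst]
  · rintro ⟨y, hy⟩
    obtain ⟨z, hz, _⟩ := Scheme.exists_preimage_of_isPullback (bcMap_isPullback K f hf) x y hy.symm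
    exact ⟨z, hz⟩

theorem prod_isPullback (X Y : SchFT F) :
    IsPullback (bcMap K (SchFT.prodSnd X Y) (SchFT.prodSnd_π X Y))
      (bcMap K (SchFT.prodFst X Y) (SchFT.prodFst_π X Y)) (Y.baseChange K).π (X.baseChange K).π := by
  have h1 := (bcMap_isPullback K (SchFT.prodFst X Y) (SchFT.prodFst_π X Y)).flip
  have h2 := h1.paste_horiz (SchFT.prod_isPullback X Y).flip
  refine IsPullback.of_right (h₁₂ := bcFst K Y)
    (h₂₂ := Spec.map (CommRingCat.ofHom (algebraMap F K))) (v₁₃ := Y.π) ?_ ?_ (bc_isPullback K Y)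
  · rw [bcMap_fst, ← (bc_isPullback K X).w]
    exact h2
  · rw [bcMap_π, bcMap_π]

/-- Base change is a motivic measure. -/
theorem isMotivicMeasure_baseChange :
    IsMotivicMeasure fun X : SchFT F => cls (X.baseChange K) where
  iso X Y := by
    rintro ⟨e, he⟩
    have : IsIso (bcMap K e.hom he) :=
      MorphismProperty.of_isPullback (P := MorphismProperty.isomorphisms Scheme)
        (bcMap_isPullback K e.hom he).flip (inferInstanceAs (IsIso e.hom))
    exact isMotivicMeasure_cls.iso _ _ ⟨asIso (bcMap K e.hom he), bcMap_π K e.hom he⟩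
  add X Y U := by
    rintro ⟨i, j, hi, hj, hiπ, hjπ, h⟩
    refine isMotivicMeasure_cls.add _ _ _ ⟨bcMap K i hiπ, bcMap K j hjπ,
      MorphismProperty.of_isPullback (bcMap_isPullback K i hiπ).flip hi,
      MorphismProperty.of_isPullback (bcMap_isPullback K j hjπ).flip hj,
      bcMap_π K i hiπ, bcMap_π K j hjπ, ?_⟩
    rw [range_bcMap, range_bcMap, h, Set.preimage_compl]
  red X Y := by
    rintro ⟨i, hi, hs, _, hiπ⟩
    have : IsClosedImmersion (bcMap K i hiπ) :=
      MorphismProperty.of_isPullback (bcMap_isPullback K i hiπ).flip hi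
    refine cls_eq_of_surjective _ _ (bcMap K i hiπ) ?_ (bcMap_π K i hiπ)
    rw [← Set.range_eq_univ, range_bcMap, Set.range_eq_univ.2 hs, Set.preimage_univ]
  mul X Y := by
    rw [← isMotivicMeasure_cls.mul]
    refine isMotivicMeasure_cls.iso _ _ ⟨(prod_isPullback K X Y).flip.isoPullback, ?_⟩
    refine ((prod_isPullback K X Y).flip.isoPullback_hom_fst_assoc _).trans ?_
    rw [bcMap_π]
  one := by
    rw [← isMotivicMeasure_cls.one]
    have : IsIso ((SchFT.point F).baseChange K).π :=
      MorphismProperty.of_isPullback (P := MorphismProperty.isomorphisms Scheme)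
        (bc_isPullback K (SchFT.point F)) (inferInstanceAs (IsIso (𝟙 _)))
    exact isMotivicMeasure_cls.iso _ _
      ⟨@asIso _ _ _ _ _ this, Category.comp_id _⟩

/-- The base change homomorphism `b : GK_F → GK_K`, `[X] ↦ [X_K]`. -/
noncomputable def baseChange : GK F →+* GK K := lift (isMotivicMeasure_baseChange K)

end BaseChange

end GK

/-- `f : X → B` is a Zariski locally trivial fibre bundle with fibre `T`, over `F`: `B` is covered
by opens `U` with `X ×_B U ≅ U × T` over `U`. -/
def IsFibreBundle {F : Type u} [Field F] {X B : SchFT F} (f : X.X ⟶ B.X) (T : SchFT F) : Prop :=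
  f ≫ B.π = X.π ∧ ∀ b : B.X, ∃ U : B.X.Opens, b ∈ U ∧
    ∃ e : pullback f U.ι ≅ pullback (U.ι ≫ B.π) T.π,
      e.hom ≫ pullback.fst (U.ι ≫ B.π) T.π = pullback.snd f U.ι

namespace SchFT

variable {F : Type u} [Field F]

/-- The degree over `F` of the residue field of `X` at `x`. -/
noncomputable def deg (X : SchFT F) (x : X.X) : ℕ := X.π.residueDegree x

/-- The set of closed points of `X` of degree `d`. -/
def closedPoints (X : SchFT F) (d : ℕ) : Set X.X := {x | IsClosed {x} ∧ X.deg x = d}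

/-- The zeta function `Z(X,t) = ∏_{x ∈ |X|} (1 - t^deg(x))⁻¹`, as an element of `W(ℤ)`
(the equal factors, of which there are finitely many for `F` finite, are collected). -/
noncomputable def zeta (X : SchFT F) : BigWitt ℤ :=
  BigWitt.infSum fun d => (X.closedPoints d).ncard • BigWitt.vTeich d 1

end SchFT

end Schemes

universe u

/-!
The zeta function is determined by numbers of rational points, and every assertion of the theorem
is visible on points. For a finite extension `L` of `k`, an `L`-point of `X` is a point `x` of `X`
with a `k`-embedding of `κ(x)` into `L`. The existence of an embedding forces `κ(x)` to be finite
over `k`, so that `x` is closed by Zariski's lemma; and since finite extensions of finite fields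
are Galois, a closed point of degree `d` admits exactly `d` embeddings if `d ∣ [L : k]` and none
otherwise. Hence `#X(L) = ∑_{d ∣ [L : k]} d · #{closed points of degree d}`, which is the ghost
component of `Z(X,t)` of index `[L : k]` (`SchFT.ghost_zeta`).

As `ℤ` has characteristic zero, an element of `W(ℤ)` is determined by its ghost components
(`SchFT.zeta_eq_of_ghost`), and these turn sums and products of `W(ℤ)` into sums and products of
integers and `F_m` into multiplication of the index by `m`. So it remains to compare sets of
`L`-points. Those of a product are pairs of points; for a closed subscheme and its open complement
they form a partition, as the spectrum of a field maps into one of the two; on a locally trivial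
bundle, the fibre over each `L`-point of the base is in bijection with `T(L)`; and for `k ⊆ K ⊆ L`
the `L`-points of `X_K` over `K` are those of `X` over `k`, where `[L : k] = m [L : K]`.
-/

section

open AlgebraicGeometry CategoryTheory CategoryTheory.Limits

/-! ### Points with values in a field extension -/

namespace SchFT

section Points

variable {F : Type u} [Field F]

/-- The set `X(L)` of `L`-valued points of `X` over `F`. -/
abbrev points (X : SchFT F) (L : Type u) [Field L] [Algebra F L] : Type u :=
  {p : Spec (.of L) ⟶ X.X // p ≫ X.π = Spec.map (CommRingCat.ofHom (algebraMap F L))}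

/-- The structure map `F ⟶ κ(x)` of the residue field at `x`. -/
noncomputable def residueFieldHom (X : SchFT F) (x : X.X) : .of F ⟶ X.X.residueField x :=
  Spec.preimage (X.X.fromSpecResidueField x ≫ X.π)

theorem SpecMap_residueFieldHom (X : SchFT F) (x : X.X) :
    Spec.map (X.residueFieldHom x) = X.X.fromSpecResidueField x ≫ X.π :=
  Spec.map_preimage _

/-- `κ(x)` as an extension of `F`, along the structure morphism of `X`. -/
noncomputable instance (X : SchFT F) (x : X.X) : Algebra F (X.X.residueField x) :=
  (X.residueFieldHom x).hom.toAlgebra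

/-- The residue field of `Spec F` at its point is `F`. -/
theorem isIso_fromSpecResidueField_Spec (y : Spec (.of F)) :
    IsIso ((Spec (.of F)).fromSpecResidueField y) := by
  have h : IsClosed {y} := by
    rw [Set.eq_univ_of_forall (s := {y}) fun z => Subsingleton.elim z y]
    exact isClosed_univ
  have := isClosed_singleton_iff_isClosedImmersion.1 h
  have : Surjective ((Spec (.of F)).fromSpecResidueField y) :=
    ⟨fun z => ⟨default, Subsingleton.elim _ z⟩⟩
  exact isIso_of_isClosedImmersion_of_surjective _

/-- `deg` is computed over the residue field of the point of `Spec F`; that field is `F`. -/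
theorem deg_eq_finrank (X : SchFT F) (x : X.X) :
    X.deg x = Module.finrank F (X.X.residueField x) := by
  have := isIso_fromSpecResidueField_Spec (F := F) (X.π x)
  set g : .of F ⟶ (Spec (.of F)).residueField (X.π x) :=
    Spec.preimage ((Spec (.of F)).fromSpecResidueField (X.π x)) with hg
  have hgm : Spec.map g = (Spec (.of F)).fromSpecResidueField (X.π x) := Spec.map_preimage _
  have : IsIso (Spec.map g) := by rw [hgm]; infer_instance
  have : IsIso g := (ConcreteCategory.isIso_iff_bijective g).2 (isIso_SpecMap_iff.1 this)
  have hc : g ≫ X.π.residueFieldMap x = X.residueFieldHom x := by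
    apply Spec.map_injective
    rw [Spec.map_comp, hgm, SpecMap_residueFieldHom]
    exact X.π.SpecMap_residueFieldMap_fromSpecResidueField x
  let := (X.π.residueFieldMap x).hom.toAlgebra
  refine (Algebra.finrank_eq_of_equiv_equiv (asIso g).commRingCatIsoToRingEquiv
    (RingEquiv.refl (X.X.residueField x)) ?_).symm
  exact congrArg CommRingCat.Hom.hom hc

variable (L : Type u) [Field L] [Algebra F L]

/-- An `L`-point of `X` is a point `x` of `X` with an embedding of `κ(x)` into `L` over `F`. -/
noncomputable def pointsEquiv (X : SchFT F) :
    X.points L ≃ Σ x : X.X, (X.X.residueField x →ₐ[F] L) := by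
  refine Equiv.trans (Equiv.subtypeEquiv (q := fun s => X.residueFieldHom s.1 ≫ s.2 =
    CommRingCat.ofHom (algebraMap F L)) (Scheme.SpecToEquivOfField L X.X) ?_) ?_
  · intro p
    obtain ⟨s, rfl⟩ := (Scheme.SpecToEquivOfField L X.X).symm.surjective p
    rw [Equiv.apply_symm_apply, Scheme.SpecToEquivOfField_symm_apply, Category.assoc,
      ← SpecMap_residueFieldHom, ← Spec.map_comp, Spec.map_inj]
  · exact
    { toFun s := ⟨s.1.1, { s.1.2.hom with
        commutes' := fun r => RingHom.congr_fun (congrArg CommRingCat.Hom.hom s.2) r }⟩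
      invFun s := ⟨⟨s.1, CommRingCat.ofHom s.2.toRingHom⟩,
        CommRingCat.hom_ext s.2.comp_algebraMap⟩
      left_inv s := rfl
      right_inv s := rfl }

variable {L}

instance : JacobsonSpace (Spec (.of F)) :=
  inferInstanceAs (JacobsonSpace (PrimeSpectrum F))

theorem jacobsonSpace (X : SchFT F) : JacobsonSpace X.X := LocallyOfFiniteType.jacobsonSpace X.π

/-- A form of Zariski's lemma: the closed points are those with residue field finite over `F`. -/
theorem isClosed_singleton_iff_finite (X : SchFT F) (x : X.X) :
    IsClosed {x} ↔ Module.Finite F (X.X.residueField x) := by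
  have := X.jacobsonSpace
  have h : IsFinite (X.X.fromSpecResidueField x ≫ X.π) ↔
      Module.Finite F (X.X.residueField x) := by
    rw [← SpecMap_residueFieldHom, IsFinite.SpecMap_iff]
    rfl
  rw [← h]
  constructor
  · intro hx
    have := isClosed_singleton_iff_isClosedImmersion.1 hx
    exact isFinite_iff_locallyOfFiniteType_of_jacobsonSpace.2 inferInstance
  · intro hx
    exact isClosed_singleton_iff_locallyOfFiniteType.2
      (locallyOfFiniteType_of_comp (X.X.fromSpecResidueField x) X.π)

theorem deg_pos (X : SchFT F) {x : X.X} (hx : IsClosed {x}) : 0 < X.deg x := by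
  have := (X.isClosed_singleton_iff_finite x).1 hx
  rw [deg_eq_finrank]
  exact Module.finrank_pos

theorem isClosed_of_algHom [Module.Finite F L] (X : SchFT F) {x : X.X}
    (f : X.X.residueField x →ₐ[F] L) : IsClosed {x} :=
  (X.isClosed_singleton_iff_finite x).2
    (Module.Finite.of_injective f.toLinearMap f.toRingHom.injective)

theorem _root_.Finite.algHom_of_finiteType {k A L : Type*} [CommRing k] [CommRing A] [Algebra k A]
    [Semiring L] [Algebra k L] [Algebra.FiniteType k A] [Finite L] : Finite (A →ₐ[k] L) := by
  obtain ⟨s, hs⟩ := Algebra.FiniteType.out (R := k) (A := A)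
  refine Finite.of_injective (fun (f : A →ₐ[k] L) (a : s) => f a) fun f g h => ?_
  refine AlgHom.ext_of_adjoin_eq_top hs fun a ha => ?_
  exact congrFun h ⟨a, ha⟩

/-- The points of an affine scheme of finite type are the homomorphisms out of a finitely
generated algebra. -/
theorem finite_lifts_Spec {R : CommRingCat.{u}} (f : Spec R ⟶ Spec (.of F))
    [h : LocallyOfFiniteType f] [Finite L] : Finite {p : Spec (.of L) ⟶ Spec R //
      p ≫ f = Spec.map (CommRingCat.ofHom (algebraMap F L))} := by
  obtain ⟨φ, rfl⟩ := Spec.map_surjective f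
  let := φ.hom.toAlgebra
  have hφ : φ.hom.FiniteType := (HasRingHomProperty.Spec_iff (P := @LocallyOfFiniteType)).1 ‹_›
  have : Algebra.FiniteType F R := hφ
  have := Finite.algHom_of_finiteType (k := F) (A := R) (L := L)
  refine Finite.of_surjective (α := R →ₐ[F] L) (fun g => ⟨Spec.map (CommRingCat.ofHom g.toRingHom),
    by rw [← Spec.map_comp]; exact congrArg Spec.map (CommRingCat.hom_ext g.comp_algebraMap)⟩) ?_
  rintro ⟨p, hp⟩
  obtain ⟨ψ, rfl⟩ := Spec.map_surjective p
  rw [← Spec.map_comp, Spec.map_inj] at hp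
  exact ⟨{ ψ.hom with commutes' := fun r => RingHom.congr_fun (congrArg CommRingCat.Hom.hom hp) r },
    rfl⟩

instance (X : SchFT F) : CompactSpace X.X :=
  (quasiCompact_iff_compactSpace X.π).1 inferInstance

theorem exists_lift_of_isOpenImmersion {X Y : Scheme.{u}} (j : Y ⟶ X) [IsOpenImmersion j]
    (p : Spec (.of L) ⟶ X) {t : Spec (.of L)} (h : p t ∈ Set.range j) :
    ∃ q : Spec (.of L) ⟶ Y, q ≫ j = p := by
  refine ⟨IsOpenImmersion.lift j p ?_, IsOpenImmersion.lift_fac _ _ _⟩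
  rintro _ ⟨s, rfl⟩
  rwa [Subsingleton.elim s t]

/-- A point with values in a field factors through a closed subscheme as soon as it does so on
underlying spaces: the base change of the closed immersion is surjective onto a reduced scheme. -/
theorem exists_lift_of_isClosedImmersion {X Y : Scheme.{u}} (i : Y ⟶ X) [IsClosedImmersion i]
    (p : Spec (.of L) ⟶ X) {t : Spec (.of L)} (h : p t ∈ Set.range i) :
    ∃ q : Spec (.of L) ⟶ Y, q ≫ i = p := by
  have hs : Surjective (pullback.snd i p) := by
    refine ⟨fun s => ?_⟩
    obtain ⟨y, hy⟩ := h
    obtain ⟨z, _, hz⟩ := Scheme.exists_preimage_of_isPullback (IsPullback.of_hasPullback i p) y s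
      (by rw [hy, Subsingleton.elim s t])
    exact ⟨z, hz⟩
  have := isIso_of_isClosedImmersion_of_surjective (pullback.snd i p)
  exact ⟨inv (pullback.snd i p) ≫ pullback.fst i p, by
    rw [Category.assoc, pullback.condition, IsIso.inv_hom_id_assoc]⟩

instance finite_points (X : SchFT F) [Finite L] : Finite (X.points L) := by
  let 𝒰 := X.X.affineCover.finiteSubcover
  have hfin (i : 𝒰.I₀) : Finite {p : Spec (.of L) ⟶ 𝒰.X i //
      p ≫ 𝒰.f i ≫ X.π = Spec.map (CommRingCat.ofHom (algebraMap F L))} :=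
    have : LocallyOfFiniteType (𝒰.f i ≫ X.π) := inferInstance
    finite_lifts_Spec (h := this) (𝒰.f i ≫ X.π)
  refine Finite.of_surjective (α := Σ i : 𝒰.I₀, {p : Spec (.of L) ⟶ 𝒰.X i //
      p ≫ 𝒰.f i ≫ X.π = Spec.map (CommRingCat.ofHom (algebraMap F L))})
    (fun s => ⟨s.2.1 ≫ 𝒰.f s.1, by rw [Category.assoc]; exact s.2.2⟩) ?_
  rintro ⟨p, hp⟩
  obtain ⟨i, y, hy⟩ := 𝒰.exists_eq (p default)
  obtain ⟨q, rfl⟩ := exists_lift_of_isOpenImmersion (𝒰.f i) p ⟨y, hy⟩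
  exact ⟨⟨i, q, by rw [← hp, Category.assoc]⟩, rfl⟩

end Points

end SchFT

/-! ### Counting points over finite fields -/

/-- `FiniteField.Extension`, moved to the universe of `k`. -/
theorem FiniteField.exists_extension_finrank_eq (k : Type u) [Field k] [Finite k] {n : ℕ}
    (hn : n ≠ 0) : ∃ (L : Type u) (_ : Field L) (_ : Algebra k L),
      Finite L ∧ Module.finrank k L = n := by
  obtain ⟨p, _⟩ := CharP.exists k
  have : Fact p.Prime := ⟨CharP.char_is_prime k p⟩
  have : NeZero n := ⟨hn⟩
  refine ⟨ULift.{u} (FiniteField.Extension k p n), inferInstance, inferInstance, inferInstance, ?_⟩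
  rw [(ULift.algEquiv (R := k) (A := FiniteField.Extension k p n)).toLinearEquiv.finrank_eq]
  exact FiniteField.finrank_extension k p n

namespace SchFT

section Count

variable {k : Type u} [Field k] [Finite k]

/-- Each closed point of degree `d` is the image of a point with values in the extension of
degree `d`, of which there are finitely many. -/
theorem finite_closedPoints (X : SchFT k) {d : ℕ} (hd : 0 < d) : (X.closedPoints d).Finite := by
  obtain ⟨L, _, _, _, hL⟩ := FiniteField.exists_extension_finrank_eq k hd.ne'
  have : Finite (Σ x : X.X, (X.X.residueField x →ₐ[k] L)) := Finite.of_equiv _ (X.pointsEquiv L)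
  refine (Set.finite_range fun s : Σ x : X.X, (X.X.residueField x →ₐ[k] L) => s.1).subset ?_
  rintro x ⟨_, hx⟩
  obtain ⟨f⟩ := FiniteField.nonempty_algHom_of_finrank_dvd (F := k) (K := X.X.residueField x)
    (L := L) (by rw [hL, ← hx, deg_eq_finrank])
  exact ⟨⟨x, f⟩, rfl⟩

/-- A closed point of degree `d` underlies `d` points with values in an extension of degree
divisible by `d`, and none in any other finite extension. -/
theorem natCard_points (X : SchFT k) (L : Type u) [Field L] [Algebra k L] [Finite L] :
    Nat.card (X.points L) =
      ∑ d ∈ (Module.finrank k L).divisors, (X.closedPoints d).ncard * d := by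
  classical
  have : Module.Finite k L := .of_finite
  have hr : Module.finrank k L ≠ 0 := Module.finrank_pos.ne'
  -- `S d` is the set of closed points of degree `d`, and `T` that of the `x` with `κ(x) ↪ L`
  let S (d : ℕ) : Finset X.X := if h : 0 < d then (X.finite_closedPoints h).toFinset else ∅
  have hS {d : ℕ} (hd : 0 < d) (x : X.X) : x ∈ S d ↔ IsClosed {x} ∧ X.deg x = d := by
    simp only [S, dif_pos hd, Set.Finite.mem_toFinset]
    rfl
  have hpos {d : ℕ} (hd : d ∈ (Module.finrank k L).divisors) : 0 < d := Nat.pos_of_mem_divisors hd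
  let T := (Module.finrank k L).divisors.biUnion S
  have hT (x : X.X) (f : X.X.residueField x →ₐ[k] L) : x ∈ T := by
    have hd : X.deg x ∈ (Module.finrank k L).divisors := by
      rw [Nat.mem_divisors, deg_eq_finrank]
      exact ⟨FiniteField.nonempty_algHom_iff_finrank_dvd.1 ⟨f⟩, hr⟩
    exact Finset.mem_biUnion.2 ⟨_, hd, (hS (hpos hd) x).2 ⟨X.isClosed_of_algHom f, rfl⟩⟩
  have e : X.points L ≃ Σ x : T, (X.X.residueField x.1 →ₐ[k] L) :=
    (X.pointsEquiv L).trans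
      { toFun s := ⟨⟨s.1, hT s.1 s.2⟩, s.2⟩
        invFun s := ⟨s.1.1, s.2⟩
        left_inv s := rfl
        right_inv s := rfl }
  have hfin (x : T) : Finite (X.X.residueField x.1 →ₐ[k] L) :=
    have := Finite.of_equiv _ e
    Finite.of_injective (β := Σ x : T, (X.X.residueField x.1 →ₐ[k] L)) (fun f => ⟨x, f⟩)
      fun f g h => eq_of_heq (Sigma.mk.inj h).2
  rw [Nat.card_congr e, Nat.card_sigma,
    Finset.sum_coe_sort T fun x => Nat.card (X.X.residueField x →ₐ[k] L),
    Finset.sum_biUnion]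
  · refine Finset.sum_congr rfl fun d hd => ?_
    have hc : (X.closedPoints d).ncard = (S d).card := by
      rw [Set.ncard_eq_toFinset_card _ (X.finite_closedPoints (hpos hd))]
      simp only [S, dif_pos (hpos hd)]
    rw [hc, ← smul_eq_mul, ← Finset.sum_const]
    refine Finset.sum_congr rfl fun x hx => ?_
    obtain ⟨_, rfl⟩ := (hS (hpos hd) x).1 hx
    rw [deg_eq_finrank] at hd ⊢
    exact FiniteField.natCard_algHom_of_finrank_dvd (Nat.dvd_of_mem_divisors hd)
  · intro d hd e he hde
    refine Finset.disjoint_left.2 fun x hx hx' => hde ?_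
    rw [← ((hS (hpos hd) x).1 hx).2, ((hS (hpos he) x).1 hx').2]

/-- The ghost components of the zeta function count points:
`t Z'(X,t) / Z(X,t) = ∑ #X(𝔽_{q^r}) t^r`. -/
theorem ghost_zeta (X : SchFT k) (L : Type u) [Field L] [Algebra k L] [Finite L] :
    BigWitt.ghost (Module.finrank k L) X.zeta = Nat.card (X.points L) := by
  have : Module.Finite k L := .of_finite
  have hr : Module.finrank k L ≠ 0 := Module.finrank_pos.ne'
  rw [zeta, BigWitt.ghost_infSum (fun d => nsmul_mem (BigWitt.vTeich_mem_fil d 1) _),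
    natCard_points, Nat.cast_sum, ← BigWitt.Icc_sum_eq_divisors hr]
  refine Finset.sum_congr rfl fun d hd => ?_
  rw [← BigWitt.ghostHom_apply, map_nsmul, BigWitt.ghostHom_apply,
    BigWitt.ghost_vTeich (by simp at hd; omega) hr]
  split_ifs <;> simp

/-- An element of `W(ℤ)` is a zeta function if its ghost components are the numbers of points. -/
theorem zeta_eq_of_ghost (X : SchFT k) (P : BigWitt ℤ)
    (h : ∀ (L : Type u) [Field L] [Algebra k L] [Finite L],
      (Nat.card (X.points L) : ℤ) = BigWitt.ghost (Module.finrank k L) P) : X.zeta = P := by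
  refine BigWitt.eq_of_ghost fun r hr => ?_
  obtain ⟨L, _, _, _, rfl⟩ := FiniteField.exists_extension_finrank_eq k hr
  rw [ghost_zeta, h]

end Count

end SchFT

/-! ### Comparison of sets of points -/

namespace SchFT

section Bijections

variable {F : Type u} [Field F] (L : Type u) [Field L] [Algebra F L]

theorem natCard_points_point : Nat.card ((point F).points L) = 1 := by
  rw [Nat.card_eq_one_iff_unique]
  refine ⟨⟨fun p q => Subtype.ext ?_⟩, ⟨⟨Spec.map (CommRingCat.ofHom (algebraMap F L)),
    Category.comp_id _⟩⟩⟩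
  exact (Category.comp_id _).symm.trans ((p.2.trans q.2.symm).trans (Category.comp_id _))

/-- The map on `L`-points induced by a morphism over `F`. -/
noncomputable def pointsMap {X Y : SchFT F} (f : Y.X ⟶ X.X) (hf : f ≫ X.π = Y.π) (p : Y.points L) :
    X.points L :=
  ⟨p.1 ≫ f, by rw [Category.assoc, hf, p.2]⟩

theorem pointsMap_injective {X Y : SchFT F} (f : Y.X ⟶ X.X) [Mono f] (hf : f ≫ X.π = Y.π) :
    Function.Injective (pointsMap L f hf) := fun _ _ h =>
  Subtype.ext ((cancel_mono f).1 (congrArg Subtype.val h))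

theorem range_pointsMap_of_isOpenImmersion {X Y : SchFT F} (f : Y.X ⟶ X.X) [IsOpenImmersion f]
    (hf : f ≫ X.π = Y.π) :
    Set.range (pointsMap L f hf) = {p | p.1 default ∈ Set.range f} := by
  ext p
  constructor
  · rintro ⟨q, rfl⟩
    exact ⟨q.1 default, (Scheme.Hom.comp_apply _ _ _).symm⟩
  · intro h
    obtain ⟨q, hq⟩ := exists_lift_of_isOpenImmersion f p.1 h
    exact ⟨⟨q, by rw [← hf, ← Category.assoc, hq, p.2]⟩, Subtype.ext hq⟩

theorem range_pointsMap_of_isClosedImmersion {X Y : SchFT F} (f : Y.X ⟶ X.X)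
    [IsClosedImmersion f] (hf : f ≫ X.π = Y.π) :
    Set.range (pointsMap L f hf) = {p | p.1 default ∈ Set.range f} := by
  ext p
  constructor
  · rintro ⟨q, rfl⟩
    exact ⟨q.1 default, (Scheme.Hom.comp_apply _ _ _).symm⟩
  · intro h
    obtain ⟨q, hq⟩ := exists_lift_of_isClosedImmersion f p.1 h
    exact ⟨⟨q, by rw [← hf, ← Category.assoc, hq, p.2]⟩, Subtype.ext hq⟩

variable {L}

theorem natCard_points_of_isIsoOver {X Y : SchFT F} (h : X.IsIsoOver Y) :
    Nat.card (X.points L) = Nat.card (Y.points L) := by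
  obtain ⟨e, he⟩ := h
  refine Nat.card_eq_of_bijective (pointsMap L e.hom he) ⟨pointsMap_injective L _ _, fun p => ?_⟩
  exact ⟨⟨p.1 ≫ e.inv, by rw [← he, Category.assoc, e.inv_hom_id_assoc, p.2]⟩,
    Subtype.ext (by simp [pointsMap])⟩

theorem natCard_points_of_isReduction {X Y : SchFT F} (h : X.IsReduction Y) :
    Nat.card (X.points L) = Nat.card (Y.points L) := by
  obtain ⟨i, _, hs, _, hi⟩ := h
  refine (Nat.card_eq_of_bijective (pointsMap L i hi) ⟨pointsMap_injective L _ _, ?_⟩).symm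
  rw [← Set.range_eq_univ, range_pointsMap_of_isClosedImmersion, Set.range_eq_univ.2 hs]
  rfl

theorem natCard_points_of_isClosedOpenPartition [Finite L] {X Y U : SchFT F}
    (h : X.IsClosedOpenPartition Y U) :
    Nat.card (X.points L) = Nat.card (Y.points L) + Nat.card (U.points L) := by
  obtain ⟨i, j, _, _, hi, hj, hr⟩ := h
  have hc : Set.range (pointsMap L j hj) = (Set.range (pointsMap L i hi))ᶜ := by
    rw [range_pointsMap_of_isOpenImmersion, range_pointsMap_of_isClosedImmersion, hr]
    rfl
  have hy := Set.ncard_range_of_injective (pointsMap_injective L i hi)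
  have hu := Set.ncard_range_of_injective (pointsMap_injective L j hj)
  rw [← hy, ← hu, hc, Set.ncard_add_ncard_compl]

theorem natCard_points_prod (X Y : SchFT F) :
    Nat.card ((X.prod Y).points L) = Nat.card (X.points L) * Nat.card (Y.points L) := by
  rw [← Nat.card_prod]
  refine Nat.card_eq_of_bijective
    (fun p => (pointsMap L (prodFst X Y) rfl p, pointsMap L (prodSnd X Y) (prodSnd_π X Y) p))
    ⟨fun p q h => ?_, fun ⟨p, q⟩ => ?_⟩
  · obtain ⟨h1, h2⟩ := Prod.ext_iff.1 h
    exact Subtype.ext ((prod_isPullback X Y).hom_ext (congrArg Subtype.val h1)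
      (congrArg Subtype.val h2))
  · have hw : p.1 ≫ X.π = q.1 ≫ Y.π := p.2.trans q.2.symm
    refine ⟨⟨(prod_isPullback X Y).lift p.1 q.1 hw, ?_⟩, Prod.ext (Subtype.ext ?_)
      (Subtype.ext ?_)⟩
    · rw [← prodFst_π, (prod_isPullback X Y).lift_fst_assoc, p.2]
    · exact (prod_isPullback X Y).lift_fst _ _ _
    · exact (prod_isPullback X Y).lift_snd _ _ _

/-- Over an `L`-point `p` of `B`, a locally trivial bundle has as many `L`-points as its fibre. -/
theorem natCard_fibre_points {X B T : SchFT F} {f : X.X ⟶ B.X} (h : IsFibreBundle f T)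
    (p : B.points L) :
    Nat.card {q : X.points L // pointsMap L f h.1 q = p} = Nat.card (T.points L) := by
  obtain ⟨U, hU, e, he⟩ := h.2 (p.1 default)
  obtain ⟨p', hp'⟩ := exists_lift_of_isOpenImmersion U.ι p.1 (t := default) (by simpa using hU)
  have hpB : p' ≫ U.ι ≫ B.π = Spec.map (CommRingCat.ofHom (algebraMap F L)) := by
    rw [← Category.assoc, hp', p.2]
  have he' : e.inv ≫ pullback.snd f U.ι = pullback.fst (U.ι ≫ B.π) T.π := by
    rw [← he, e.inv_hom_id_assoc]
  have hq (t : T.points L) : pullback.lift p' t.1 (hpB.trans t.2.symm) ≫ e.inv ≫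
      pullback.fst f U.ι ≫ f = p.1 := by
    rw [pullback.condition, reassoc_of% he', pullback.lift_fst_assoc, hp']
  symm
  refine Nat.card_eq_of_bijective (fun t : T.points L =>
    ⟨⟨pullback.lift p' t.1 (hpB.trans t.2.symm) ≫ e.inv ≫ pullback.fst f U.ι, ?_⟩, ?_⟩)
    ⟨fun s t hst => ?_, fun ⟨q, hqp⟩ => ?_⟩
  · rw [← h.1, Category.assoc, Category.assoc, reassoc_of% hq t, p.2]
  · exact Subtype.ext (by simpa [pointsMap] using hq t)
  · have h1 : pullback.lift p' s.1 (hpB.trans s.2.symm) ≫ e.inv ≫ pullback.fst f U.ι =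
        pullback.lift p' t.1 (hpB.trans t.2.symm) ≫ e.inv ≫ pullback.fst f U.ι :=
      congrArg (fun q => q.1.1) hst
    have h2 : pullback.lift p' s.1 (hpB.trans s.2.symm) =
        pullback.lift p' t.1 (hpB.trans t.2.symm) := by
      rw [← cancel_mono e.inv]
      -- `pullback.fst f U.ι` is a monomorphism, as a base change of `U.ι`
      rw [← cancel_mono (pullback.fst f U.ι), Category.assoc, Category.assoc, h1]
    refine Subtype.ext ?_
    rw [← pullback.lift_snd p' s.1 (hpB.trans s.2.symm), h2, pullback.lift_snd]
  · have hqf : q.1 ≫ f = p' ≫ U.ι := (congrArg Subtype.val hqp).trans hp'.symm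
    let r := pullback.lift q.1 p' hqf ≫ e.hom
    have hr : r ≫ pullback.fst _ _ = p' := by
      rw [Category.assoc, he, pullback.lift_snd]
    have hrT : (r ≫ pullback.snd _ _) ≫ T.π =
        Spec.map (CommRingCat.ofHom (algebraMap F L)) := by
      rw [Category.assoc, ← pullback.condition, reassoc_of% hr, hpB]
    refine ⟨⟨r ≫ pullback.snd _ _, hrT⟩, Subtype.ext (Subtype.ext ?_)⟩
    have : pullback.lift p' (r ≫ pullback.snd _ _) (hpB.trans hrT.symm) = r :=
      pullback.hom_ext (by rw [pullback.lift_fst, hr]) (by rw [pullback.lift_snd])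
    change pullback.lift p' (r ≫ pullback.snd _ _) _ ≫ e.inv ≫ pullback.fst f U.ι = q.1
    rw [this, Category.assoc, e.hom_inv_id_assoc, pullback.lift_fst]

theorem natCard_points_of_isFibreBundle [Finite L] {X B T : SchFT F} {f : X.X ⟶ B.X}
    (h : IsFibreBundle f T) :
    Nat.card (X.points L) = Nat.card (B.points L) * Nat.card (T.points L) := by
  have := Fintype.ofFinite (B.points L)
  rw [Nat.card_congr (Equiv.sigmaFiberEquiv (pointsMap L f h.1)).symm, Nat.card_sigma,
    Finset.sum_congr rfl fun p _ => natCard_fibre_points h p, Finset.sum_const, smul_eq_mul,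
    Finset.card_univ, Nat.card_eq_fintype_card (α := B.points L)]

theorem natCard_points_baseChange (X : SchFT F) (K : Type u) [Field K] [Algebra F K] [Algebra K L]
    [IsScalarTower F K L] :
    Nat.card ((X.baseChange K).points L) = Nat.card (X.points L) := by
  have hs : Spec.map (CommRingCat.ofHom (algebraMap K L)) ≫
      Spec.map (CommRingCat.ofHom (algebraMap F K)) =
        Spec.map (CommRingCat.ofHom (algebraMap F L)) := by
    rw [← Spec.map_comp, IsScalarTower.algebraMap_eq F K L]
    rfl
  have hp := GK.bc_isPullback K X
  refine Nat.card_eq_of_bijective (fun p : (X.baseChange K).points L =>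
    (⟨p.1 ≫ GK.bcFst K X, by rw [Category.assoc, hp.w, ← Category.assoc, p.2, hs]⟩ : X.points L))
    ⟨fun p q h => ?_, fun p => ?_⟩
  · exact Subtype.ext (hp.hom_ext (congrArg Subtype.val h) (p.2.trans q.2.symm))
  · have hw : p.1 ≫ X.π = Spec.map (CommRingCat.ofHom (algebraMap K L)) ≫
      Spec.map (CommRingCat.ofHom (algebraMap F K)) := p.2.trans hs.symm
    exact ⟨⟨hp.lift _ _ hw, hp.lift_snd _ _ _⟩, Subtype.ext (hp.lift_fst _ _ _)⟩

end Bijections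

/-! ### Properties of the zeta function -/

section Zeta

variable {k : Type u} [Field k] [Finite k]

theorem zeta_point : (point k).zeta = 1 :=
  zeta_eq_of_ghost _ _ fun L _ _ _ => by
    have : Module.Finite k L := .of_finite
    rw [natCard_points_point, BigWitt.ghost_one Module.finrank_pos.ne', Nat.cast_one]

theorem zeta_prod (X Y : SchFT k) : (X.prod Y).zeta = X.zeta * Y.zeta :=
  zeta_eq_of_ghost _ _ fun L _ _ _ => by
    have : Module.Finite k L := .of_finite
    rw [natCard_points_prod, BigWitt.ghost_mul _ _ Module.finrank_pos.ne', ghost_zeta, ghost_zeta,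
      Nat.cast_mul]

theorem zeta_npow (X : SchFT k) (n : ℕ) : (X.npow n).zeta = X.zeta ^ n := by
  induction n with
  | zero => rw [pow_zero, npow, zeta_point]
  | succ n ih => rw [pow_succ, npow, zeta_prod, ih]

variable (k) in
theorem isMotivicMeasure_zeta : IsMotivicMeasure (zeta (F := k)) where
  iso X Y h := zeta_eq_of_ghost _ _ fun L _ _ _ => by
    rw [natCard_points_of_isIsoOver h, ghost_zeta]
  add X Y U h := zeta_eq_of_ghost _ _ fun L _ _ _ => by
    rw [natCard_points_of_isClosedOpenPartition h, BigWitt.ghost_add, ghost_zeta, ghost_zeta,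
      Nat.cast_add]
  red X Y h := zeta_eq_of_ghost _ _ fun L _ _ _ => by
    rw [natCard_points_of_isReduction h, ghost_zeta]
  mul := zeta_prod
  one := zeta_point

theorem zeta_of_isFibreBundle {X B T : SchFT k} {f : X.X ⟶ B.X} (h : IsFibreBundle f T) :
    X.zeta = B.zeta * T.zeta :=
  zeta_eq_of_ghost _ _ fun L _ _ _ => by
    have : Module.Finite k L := .of_finite
    rw [natCard_points_of_isFibreBundle h, BigWitt.ghost_mul _ _ Module.finrank_pos.ne',
      ghost_zeta, ghost_zeta, Nat.cast_mul]

theorem zeta_baseChange (X : SchFT k) (m : ℕ+) (K : Type u) [Field K] [Algebra k K]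
    (hK : Module.finrank k K = m) :
    (X.baseChange K).zeta = BigWitt.frobenius m X.zeta := by
  have : Module.Finite k K := Module.finite_of_finrank_pos (hK ▸ m.pos)
  have : Finite K := Module.finite_of_finite k
  refine zeta_eq_of_ghost _ _ fun L _ _ _ => ?_
  have : Module.Finite K L := .of_finite
  let : Algebra k L := ((algebraMap K L).comp (algebraMap k K)).toAlgebra
  have : IsScalarTower k K L := .of_algebraMap_eq' rfl
  change _ = BigWitt.ghost _ (BigWitt.frobFun m X.zeta)
  rw [natCard_points_baseChange, BigWitt.ghost_frobFun m.ne_zero _ Module.finrank_pos.ne', ← hK,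
    mul_comm, Module.finrank_mul_finrank, ghost_zeta]

end Zeta

end SchFT

/-- The classes of schemes generate the Grothendieck ring. -/
theorem GK.ringHom_ext {F : Type u} [Field F] {R : Type*} [CommRing R] {f g : GK F →+* R}
    (h : ∀ X, f (GK.cls X) = g (GK.cls X)) : f = g :=
  Ideal.Quotient.ringHom_ext (MvPolynomial.ringHom_ext' (Subsingleton.elim _ _) h)

end

theorem theorem2p1 (k : Type u) [Field k] [Finite k] :
    -- the product defining the zeta function makes sense
    (∀ X : SchFT k, (∀ x : X.X, IsClosed {x} → 0 < X.deg x) ∧ ∀ d, 0 < d → (X.closedPoints d).Finite) ∧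
    -- products and powers
    (∀ X Y : SchFT k, (X.prod Y).zeta = X.zeta * Y.zeta) ∧
    (∀ (X : SchFT k) (n : ℕ), (X.npow n).zeta = X.zeta ^ n) ∧
    -- the homomorphism on the Grothendieck ring, and the motivic measure
    (∃! κ : GK k →+* BigWitt ℤ, ∀ X, κ (GK.cls X) = X.zeta) ∧
    IsMotivicMeasure (SchFT.zeta (F := k)) ∧
    -- fibre bundles
    (∀ (X B T : SchFT k) (f : X.X ⟶ B.X), IsFibreBundle f T → X.zeta = B.zeta * T.zeta) ∧
    -- base change and Frobenius
    ∀ (m : ℕ+) (K : Type u) [Field K] [Algebra k K], Module.finrank k K = m →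
      (∀ X : SchFT k, (X.baseChange K).zeta = BigWitt.frobenius m X.zeta) ∧
      ∃ (κ : GK k →+* BigWitt ℤ) (κ' : GK K →+* BigWitt ℤ),
        (∀ X, κ (GK.cls X) = X.zeta) ∧ (∀ X, κ' (GK.cls X) = X.zeta) ∧
        κ'.comp (GK.baseChange K) = (BigWitt.frobenius m).comp κ := by
  refine ⟨fun X => ⟨fun x hx => X.deg_pos hx, fun d hd => X.finite_closedPoints hd⟩,
    SchFT.zeta_prod, SchFT.zeta_npow, ?_, SchFT.isMotivicMeasure_zeta k,
    fun X B T f h => SchFT.zeta_of_isFibreBundle h, fun m K _ _ hK => ?_⟩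
  · refine ⟨GK.lift (SchFT.isMotivicMeasure_zeta k), GK.lift_cls _, fun κ hκ => ?_⟩
    exact GK.ringHom_ext fun X => by rw [hκ, GK.lift_cls]
  · have : Module.Finite k K := Module.finite_of_finrank_pos (hK ▸ m.pos)
    have : Finite K := Module.finite_of_finite k
    refine ⟨fun X => X.zeta_baseChange m K hK, GK.lift (SchFT.isMotivicMeasure_zeta k),
      GK.lift (SchFT.isMotivicMeasure_zeta K), GK.lift_cls _, GK.lift_cls _, ?_⟩
    refine GK.ringHom_ext fun X => ?_
    rw [RingHom.comp_apply, RingHom.comp_apply, GK.baseChange, GK.lift_cls, GK.lift_cls,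
      GK.lift_cls, SchFT.zeta_baseChange X m K hK]
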